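/- Let $2<p_1,p_2<\infty$ and let $(C_n)_{n\ge 0}$ be a sequence of real numbers. Fix an offset $\theta\in\mathbb{R}$ and, for $k,m\in\mathbb{Z}$, let $P_{k,m}=[2^k(m+\theta),\,2^k(m+\theta+1)]$ be the intervals of length $2^k$ in the corresponding grid ($\theta=0$: the dyadic intervals; $\theta=-\tfrac12$: the intervals of length $2^k$ centred at the points $2^k m$), and $-P_{k,m}=\{-\xi:\xi\in P_{k,m}\}$. For every such interval $P=P_{k,m}$ let $\eta^1_{P}$ and $\eta^2_{-P}$ be functions on $\mathbb{R}$ whose Fourier transforms are smooth, vanish outside $P$ and outside $-P$ respectively, and satisfy $$\Big|\tfrac{d^n}{d\xi^n}\,\widehat{\eta^1_{P}}(\xi)\Big|\le C_n |P|^{-n},\qquad \Big|\tfrac{d^n}{d\xi^n}\,\widehat{\eta^2_{-P}}(\xi)\Big|\le C_n |P|^{-n}\qquad(n\ge 0,\ \xi\in\mathbb{R}).$$ (This includes the case of rescaled copies $\widehat{\eta^i_{I}}(\xi)=\widehat{\eta^i}(|I|^{-1}(\xi-c_I))$, $c_I$ the centre of $I$, of two fixed functions $\widehat{\eta^1},\widehat{\eta^2}\in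 C^\infty(\mathbb{R})$ supported in $[-\tfrac12,\tfrac12]$.) Then the operator $$\mathcal{B}(f_1,f_2)(x)=\sup_{k\in\mathbb{Z}}\Big|\sum_{|P|=2^k}(f_1*\eta^1_{P})(x)\,(f_2*\eta^2_{-P})(x)\Big|,$$ where the inner sum runs over all $P=P_{k,m}$, $m\in\mathbb{Z}$, is well defined on $L^{p_1}(\mathbb{R})\times L^{p_2}(\mathbb{R})$ (the convolutions exist and the sums converge absolutely at every $x\in\mathbb{R}$, and $\mathcal{B}(f_1,f_2)$ is measurable), it is sublinear in each argument, and it maps $L^{p_1}(\mathbb{R})\times L^{p_2}(\mathbb{R})$ boundedly into $L^{p_1p_2/(p_1+p_2)}(\mathbb{R})$: $$\|\mathcal{B}(f_1,f_2)\|_{\frac{p_1p_2}{p_1+p_2}}\le K\,\|f_1\|_{p_1}\|f_2\|_{p_2}\qquad\text{for all } f_1\in L^{p_1}(\mathbb{R}),\ f_2\in L^{p_2}(\mathbb{R}),$$ with a constant $K<\infty$ that depends only on $p_1$, $p_2$ and $(C_n)_{n\ge0}$. -/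

import Mathlib

open MeasureTheory
open scoped FourierTransform ContDiff ENNReal NNReal Convolution

noncomputable section

/-- The frequency intervals at scale `2 ^ k`: the `m`-th interval of length `2 ^ k` in the grid with
offset `θ`. The offset `θ = 0` gives the dyadic intervals `[2 ^ k m, 2 ^ k (m + 1)]`, the offset
`θ = - 1 / 2` gives the intervals of length `2 ^ k` centred at the points `2 ^ k m`. -/
def gridInterval (θ : ℝ) (k m : ℤ) : Set ℝ :=
  Set.Icc ((2 : ℝ) ^ k * (m + θ)) ((2 : ℝ) ^ k * (m + θ + 1))

/-- The reflected interval `-P = {-ξ : ξ ∈ P}`. -/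
def reflectedGridInterval (θ : ℝ) (k m : ℤ) : Set ℝ :=
  {ξ : ℝ | -ξ ∈ gridInterval θ k m}

/-- A family of smooth frequency cutoffs `φ k m`, uniformly adapted to the intervals `J k m`, which
are intervals of length `2 ^ k`: `φ k m` is smooth, vanishes off `J k m`, and
`|(d / dξ) ^ n (φ k m)| ≤ C n * (2 ^ k) ^ (-n)`. -/
structure IsAdaptedFamily (C : ℕ → ℝ) (J : ℤ → ℤ → Set ℝ) (φ : ℤ → ℤ → ℝ → ℂ) : Prop where
  smooth : ∀ k m, ContDiff ℝ ∞ (φ k m)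
  support_subset : ∀ k m, Function.support (φ k m) ⊆ J k m
  bound : ∀ (n : ℕ) (k m : ℤ) (ξ : ℝ),
    ‖iteratedDeriv n (φ k m) ξ‖ ≤ C n * (((2 : ℝ) ^ k) ^ n)⁻¹

/-- The frequency projection `f * η`, where `η` is the inverse Fourier transform (with kernel
`exp (2 π i x ξ)`) of the cutoff `φ`. -/
def freqProj (φ : ℝ → ℂ) (f : ℝ → ℂ) : ℝ → ℂ :=
  f ⋆[ContinuousLinearMap.mul ℂ ℂ, volume] (𝓕⁻ φ)

/-- The summand `(f₁ * η¹_P)(x) (f₂ * η²_{-P})(x)` for the `m`-th interval `P` of length `2 ^ k`. -/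
def tileTerm (φ₁ φ₂ : ℤ → ℤ → ℝ → ℂ) (f₁ f₂ : ℝ → ℂ) (k m : ℤ) (x : ℝ) : ℂ :=
  freqProj (φ₁ k m) f₁ x * freqProj (φ₂ k m) f₂ x

/-- The operator `B(f₁, f₂)(x) = sup_k |∑_{|P| = 2 ^ k} (f₁ * η¹_P)(x) (f₂ * η²_{-P})(x)|`,
with values in `[0, ∞]`. -/
def maxBilinear (φ₁ φ₂ : ℤ → ℤ → ℝ → ℂ) (f₁ f₂ : ℝ → ℂ) (x : ℝ) : ℝ≥0∞ :=
  ⨆ k : ℤ, ‖∑' m : ℤ, tileTerm φ₁ φ₂ f₁ f₂ k m x‖ₑ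

end

/-!
By the Cauchy–Schwarz inequality in `m`, the operator `B(f₁, f₂)` is pointwise at most
`S₁ f₁ * S₂ f₂`, where `S f = sup_k (∑_m |f * η_{k,m}|²)^(1/2)`. With Hölder's inequality, it
remains to bound `S` on `L^p` for `p > 2`.

Let `a = 2 ^ k`. Since `(1 + (a y)²) 𝓕⁻ φ(y)` is the inverse Fourier transform of
`φ - (a / 2π)² φ''`, the number `f * η_{k,m}(x)` is the inner product of
`y ↦ f(x - y) / (1 + (a y)²)` with a function whose Fourier transform lives on the `m`-th interval.
For fixed `k` these functions are orthogonal in `m` by Plancherel, with squared `L²` norm `O(a)`, so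
Bessel's inequality bounds the square sum by a multiple of `∫ |f(x - y)|² a / (1 + (a y)²) dy`.
The kernel is radially decreasing with integral `π`, whence `S f ≤ C M(|f|²)^(1/2)` uniformly in
`k`, and the Hardy–Littlewood maximal function `M` is bounded on `L^(p/2)`.
-/

open scoped SchwartzMap

section LayerCake

variable {α : Type*} [MeasurableSpace α] {μ : Measure α} {q : ℝ}

theorem setLIntegral_Ioi_rpow_eq_top (s : ℝ) :
    ∫⁻ t in Set.Ioi (0 : ℝ), ENNReal.ofReal (t ^ s) = ⊤ := by
  by_contra h
  refine not_integrableOn_Ioi_rpow s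
    ⟨by fun_prop, (hasFiniteIntegral_iff_ofReal ?_).2 (lt_top_iff_ne_top.2 h)⟩
  filter_upwards [ae_restrict_mem measurableSet_Ioi] with t ht
  exact Real.rpow_nonneg (le_of_lt ht) s

theorem lintegral_rpow_eq_lintegral_meas_ofReal_lt_mul {F : α → ℝ≥0∞} (hF : AEMeasurable F μ)
    (hq : 0 < q) :
    ∫⁻ x, F x ^ q ∂μ = ENNReal.ofReal q *
      ∫⁻ t in Set.Ioi (0 : ℝ), μ {x | ENNReal.ofReal t < F x} * ENNReal.ofReal (t ^ (q - 1)) := by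
  by_cases htop : ∀ᵐ x ∂μ, F x ≠ ⊤
  · calc ∫⁻ x, F x ^ q ∂μ = ∫⁻ x, ENNReal.ofReal ((F x).toReal ^ q) ∂μ := by
          refine lintegral_congr_ae ?_
          filter_upwards [htop] with x hx
          rw [← ENNReal.ofReal_rpow_of_nonneg ENNReal.toReal_nonneg hq.le, ENNReal.ofReal_toReal hx]
      _ = ENNReal.ofReal q *
          ∫⁻ t in Set.Ioi (0 : ℝ), μ {x | t < (F x).toReal} * ENNReal.ofReal (t ^ (q - 1)) :=
          lintegral_rpow_eq_lintegral_meas_lt_mul μ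
            (Filter.Eventually.of_forall fun _ => ENNReal.toReal_nonneg) hF.ennreal_toReal hq
      _ = _ := by
          congr 1
          refine setLIntegral_congr_fun measurableSet_Ioi fun t ht => ?_
          congr 1
          refine measure_congr ?_
          filter_upwards [htop] with x hx
          exact propext (ENNReal.ofReal_lt_iff_lt_toReal (le_of_lt ht) hx).symm
  · have hpos : μ {x | F x = ⊤} ≠ 0 := by simpa [ae_iff] using htop
    have hF_top : ∫⁻ x, F x ^ q ∂μ = ⊤ := by
      by_contra h
      refine hpos (measure_mono_null (fun x hx => ?_)
        (ae_iff.1 (ae_lt_top' (hF.pow_const q) h)))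
      simp [show F x = ⊤ from hx, hq]
    have hlevel : ⊤ ≤ ∫⁻ t in Set.Ioi (0 : ℝ),
        μ {x | ENNReal.ofReal t < F x} * ENNReal.ofReal (t ^ (q - 1)) := by
      calc ⊤ = ∫⁻ t in Set.Ioi (0 : ℝ), μ {x | F x = ⊤} * ENNReal.ofReal (t ^ (q - 1)) := by
            rw [lintegral_const_mul _ (by fun_prop), setLIntegral_Ioi_rpow_eq_top,
              ENNReal.mul_top hpos]
        _ ≤ _ := by
            gcongr with t x
            rintro (hx : F x = ⊤)
            simp [hx]
    rw [hF_top, top_unique hlevel, ENNReal.mul_top (ENNReal.ofReal_pos.2 hq).ne']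

theorem lintegral_rpow_le_of_mul_measure_le {F f g : α → ℝ≥0∞} {A : ℝ≥0∞} (hq : 1 < q)
    (hF : AEMeasurable F μ) (hf : AEMeasurable f μ) (hg : AEMeasurable g μ)
    (h : ∀ t : ℝ, 0 < t → ENNReal.ofReal t * μ {x | ENNReal.ofReal t < F x} ≤
      A * ∫⁻ x in {x | ENNReal.ofReal t < g x}, f x ∂μ) :
    ∫⁻ x, F x ^ q ∂μ ≤ A * ENNReal.ofReal (q / (q - 1)) * ∫⁻ x, f x * g x ^ (q - 1) ∂μ := by
  have hq' : 0 < q - 1 := sub_pos.2 hq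
  -- The layer cake formula for `f μ` replaces exchanging the integrals over `t` and over `x`.
  set ν := μ.withDensity f
  have hlevel : ∀ t ∈ Set.Ioi (0 : ℝ),
      μ {x | ENNReal.ofReal t < F x} * ENNReal.ofReal (t ^ (q - 1)) ≤
        A * (ν {x | ENNReal.ofReal t < g x} * ENNReal.ofReal (t ^ (q - 1 - 1))) := by
    intro t (ht : 0 < t)
    calc μ {x | ENNReal.ofReal t < F x} * ENNReal.ofReal (t ^ (q - 1))
        = ENNReal.ofReal t * μ {x | ENNReal.ofReal t < F x} * ENNReal.ofReal (t ^ (q - 1 - 1)) := by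
          rw [← mul_div_cancel₀ (t ^ (q - 1)) ht.ne', ← Real.rpow_sub_one ht.ne' (q - 1),
            ENNReal.ofReal_mul ht.le]
          ring
      _ ≤ A * ν {x | ENNReal.ofReal t < g x} * ENNReal.ofReal (t ^ (q - 1 - 1)) := by
          gcongr ?_ * _
          exact (h t ht).trans (mul_le_mul_right (withDensity_apply_le f _) A)
      _ = _ := mul_assoc _ _ _
  calc ∫⁻ x, F x ^ q ∂μ
      = ENNReal.ofReal q * ∫⁻ t in Set.Ioi (0 : ℝ),
          μ {x | ENNReal.ofReal t < F x} * ENNReal.ofReal (t ^ (q - 1)) :=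
        lintegral_rpow_eq_lintegral_meas_ofReal_lt_mul hF (one_pos.trans hq)
    _ ≤ ENNReal.ofReal q * ∫⁻ t in Set.Ioi (0 : ℝ),
          A * (ν {x | ENNReal.ofReal t < g x} * ENNReal.ofReal (t ^ (q - 1 - 1))) :=
        mul_le_mul_right (setLIntegral_mono' measurableSet_Ioi hlevel) _
    _ = A * ENNReal.ofReal (q / (q - 1)) * (ENNReal.ofReal (q - 1) *
          ∫⁻ t in Set.Ioi (0 : ℝ),
            ν {x | ENNReal.ofReal t < g x} * ENNReal.ofReal (t ^ (q - 1 - 1))) := by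
        have hanti : Measurable fun t : ℝ => ν {x | ENNReal.ofReal t < g x} :=
          Antitone.measurable fun s t hst => measure_mono fun x hx =>
            (ENNReal.ofReal_le_ofReal hst).trans_lt hx
        rw [lintegral_const_mul _ (hanti.fun_mul (by fun_prop)), ← div_mul_cancel₀ q hq'.ne',
          ENNReal.ofReal_mul (by positivity), div_mul_cancel₀ q hq'.ne']
        ring
    _ = A * ENNReal.ofReal (q / (q - 1)) * ∫⁻ x, f x * g x ^ (q - 1) ∂μ := by
        rw [← lintegral_rpow_eq_lintegral_meas_ofReal_lt_mul
          (hg.mono_ac (withDensity_absolutelyContinuous μ f)) hq',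
          lintegral_withDensity_eq_lintegral_mul₀ hf (hg.pow_const _)]
        rfl

end LayerCake

section Maximal

/-- The centred Hardy–Littlewood maximal function of `f` with respect to `μ`. Balls of nonpositive
radius are empty and contribute `0`. -/
noncomputable def hlMaximal {X : Type*} [PseudoMetricSpace X] [MeasurableSpace X]
    (μ : Measure X) (f : X → ℝ≥0∞) (x : X) : ℝ≥0∞ :=
  ⨆ r : ℝ, ⨍⁻ y in Metric.ball x r, f y ∂μ

theorem lowerSemicontinuous_setLIntegral_ball {X : Type*} [PseudoMetricSpace X] [MeasurableSpace X]
    (μ : Measure X) (f : X → ℝ≥0∞) (r : ℝ) :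
    LowerSemicontinuous fun x => ∫⁻ y in Metric.ball x r, f y ∂μ := by
  intro x c (hc : c < ∫⁻ y in Metric.ball x r, f y ∂μ)
  have hmono : Monotone fun n : ℕ => Metric.ball x (r - 1 / (n + 1)) := fun m n hmn =>
    Metric.ball_subset_ball (sub_le_sub_left (Nat.one_div_le_one_div hmn) r)
  have hball : Metric.ball x r = ⋃ n : ℕ, Metric.ball x (r - 1 / (n + 1)) := by
    refine subset_antisymm (fun y hy => ?_) (Set.iUnion_subset fun n =>
      Metric.ball_subset_ball (sub_le_self r (by positivity)))
    obtain ⟨n, hn⟩ := exists_nat_one_div_lt (sub_pos.2 (Metric.mem_ball.1 hy))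
    exact Set.mem_iUnion.2 ⟨n, Metric.mem_ball.2 (lt_sub_comm.1 hn)⟩
  rw [hball, setLIntegral_iUnion_of_directed f hmono.directed_le] at hc
  obtain ⟨n, hn⟩ := lt_iSup_iff.1 hc
  filter_upwards [Metric.ball_mem_nhds x (Nat.one_div_pos_of_nat (α := ℝ) (n := n))] with z hz
  refine hn.trans_le (lintegral_mono_set (Metric.ball_subset ?_))
  rw [sub_sub_cancel, dist_comm]
  exact (Metric.mem_ball.1 hz).le

theorem lowerSemicontinuous_hlMaximal {G : Type*} [NormedAddCommGroup G] [MeasurableSpace G]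
    [BorelSpace G] (μ : Measure G) [μ.IsAddHaarMeasure] (f : G → ℝ≥0∞) :
    LowerSemicontinuous (hlMaximal μ f) := by
  refine lowerSemicontinuous_iSup fun r => ?_
  convert lowerSemicontinuous_setLIntegral_ball ((μ (Metric.ball 0 r))⁻¹ • μ) f r using 2 with x
  rw [laverage, Measure.restrict_apply_univ, Measure.restrict_smul, Measure.addHaar_ball_center]

theorem measurable_hlMaximal {G : Type*} [NormedAddCommGroup G] [MeasurableSpace G]
    [BorelSpace G] (μ : Measure G) [μ.IsAddHaarMeasure] (f : G → ℝ≥0∞) :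
    Measurable (hlMaximal μ f) :=
  (lowerSemicontinuous_hlMaximal μ f).measurable

theorem setLIntegral_ball_le_mul_hlMaximal {X : Type*} [PseudoMetricSpace X] [ProperSpace X]
    [MeasurableSpace X] (μ : Measure X) [IsFiniteMeasureOnCompacts μ] (f : X → ℝ≥0∞) (x : X)
    (r : ℝ) :
    ∫⁻ y in Metric.ball x r, f y ∂μ ≤ μ (Metric.ball x r) * hlMaximal μ f x := by
  rw [← measure_mul_setLAverage f measure_ball_lt_top.ne]
  gcongr
  exact le_iSup (fun r : ℝ => ⨍⁻ y in Metric.ball x r, f y ∂μ) r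

theorem exists_ball_of_lt_hlMaximal {X : Type*} [PseudoMetricSpace X] [ProperSpace X]
    [MeasurableSpace X] {μ : Measure X} [IsFiniteMeasureOnCompacts μ] {f : X → ℝ≥0∞} {x : X}
    {c : ℝ≥0∞} (h : c < hlMaximal μ f x) :
    ∃ r > 0, c * μ (Metric.ball x r) ≤ ∫⁻ y in Metric.ball x r, f y ∂μ := by
  obtain ⟨r, hr⟩ := lt_iSup_iff.1 h
  have hr_pos : 0 < r := by
    by_contra hr'
    simp [Metric.ball_eq_empty.2 (not_lt.1 hr')] at hr
  refine ⟨r, hr_pos, ?_⟩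
  rw [← measure_mul_setLAverage f measure_ball_lt_top.ne, mul_comm]
  gcongr

theorem hlMaximal_le_add_of_ae_le_add {X : Type*} [PseudoMetricSpace X] [MeasurableSpace X]
    {μ : Measure X} {f g : X → ℝ≥0∞} {c : ℝ≥0∞} (h : ∀ᵐ x ∂μ, f x ≤ g x + c) (x : X) :
    hlMaximal μ f x ≤ hlMaximal μ g x + c := by
  refine iSup_le fun r => ?_
  calc ⨍⁻ y in Metric.ball x r, f y ∂μ ≤ ⨍⁻ y in Metric.ball x r, (g y + c) ∂μ :=
        lintegral_mono_ae (Measure.ae_smul_measure (ae_restrict_of_ae h) _)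
    _ ≤ (⨍⁻ y in Metric.ball x r, g y ∂μ) + c := by
      rw [laverage, lintegral_add_right _ measurable_const, lintegral_const]
      gcongr
      · exact le_rfl
      · refine mul_le_of_le_one_right' ?_
        simp
    _ ≤ hlMaximal μ g x + c := by
      gcongr
      exact le_iSup (fun r : ℝ => ⨍⁻ y in Metric.ball x r, g y ∂μ) r

theorem hlMaximal_le_eLpNorm_top {X : Type*} [PseudoMetricSpace X] [MeasurableSpace X]
    (μ : Measure X) (f : X → ℝ≥0∞) (x : X) : hlMaximal μ f x ≤ eLpNorm f ⊤ μ := by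
  have hf : ∀ᵐ y ∂μ, f y ≤ 0 + eLpNorm f ⊤ μ := by
    simpa [eLpNorm_exponent_top] using ae_le_eLpNormEssSup (f := f) (μ := μ)
  simpa [hlMaximal] using hlMaximal_le_add_of_ae_le_add (g := 0) hf x

variable {E : Type*} [NormedAddCommGroup E] [NormedSpace ℝ E] [FiniteDimensional ℝ E]
  [MeasurableSpace E] [BorelSpace E] {μ : Measure E} [μ.IsAddHaarMeasure]

theorem radius_le_of_measure_ball_le [Nontrivial E] {x : E} {r : ℝ} {M : ℝ≥0∞} (hM : M ≠ ⊤)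
    (hr : 0 ≤ r) (h : μ (Metric.ball x r) ≤ M) :
    r ≤ max 1 (M / μ (Metric.ball 0 1)).toReal := by
  rcases le_total r 1 with hr_one | hr_one
  · exact le_max_of_le_left hr_one
  have hball : μ (Metric.ball (0 : E) 1) ≠ 0 := (Metric.measure_ball_pos μ 0 one_pos).ne'
  rw [Measure.addHaar_ball μ x hr,
    ← ENNReal.le_div_iff_mul_le (.inl hball) (.inl measure_ball_lt_top.ne),
    ENNReal.ofReal_le_iff_le_toReal (ENNReal.div_ne_top hM hball)] at h
  exact le_max_of_le_right ((le_self_pow₀ hr_one Module.finrank_pos.ne').trans h)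

theorem mul_measure_lt_hlMaximal_le [Nontrivial E] (f : E → ℝ≥0∞) {c : ℝ≥0∞} (hc : c ≠ 0)
    (hc' : c ≠ ⊤) :
    c * μ {x | c < hlMaximal μ f x} ≤ 4 ^ Module.finrank ℝ E * ∫⁻ y, f y ∂μ := by
  by_cases hf : ∫⁻ y, f y ∂μ = ⊤
  · simp [hf]
  set S := {x | c < hlMaximal μ f x}
  have hex : ∀ x : S, ∃ r > 0, c * μ (Metric.ball x.1 r) ≤ ∫⁻ y in Metric.ball x.1 r, f y ∂μ :=
    fun x => exists_ball_of_lt_hlMaximal x.2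
  choose r hr_pos hr using hex
  have hr_le : ∀ x : S, r x ≤ max 1 ((∫⁻ y, f y ∂μ) / c / μ (Metric.ball 0 1)).toReal := fun x =>
    radius_le_of_measure_ball_le (ENNReal.div_ne_top hf hc) (hr_pos x).le <|
      ENNReal.le_div_iff_mul_le (.inl hc) (.inl hc') |>.2 <|
        mul_comm c _ ▸ (hr x).trans (setLIntegral_le_lintegral _ _)
  obtain ⟨u, -, hdisj, hcov⟩ := Vitali.exists_disjoint_subfamily_covering_enlargement_closedBall
    Set.univ (fun x : S => x.1) r _ (fun x _ => hr_le x) 4 (by norm_num)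
  have hu : u.Countable := hdisj.countable_of_nonempty_interior fun x _ =>
    (Metric.nonempty_ball.2 (hr_pos x)).mono Metric.ball_subset_interior_closedBall
  have hcover : S ⊆ ⋃ b ∈ u, Metric.closedBall b.1 (4 * r b) := fun x hx =>
    let ⟨b, hb, hsub⟩ := hcov ⟨x, hx⟩ trivial
    Set.mem_biUnion hb (hsub (Metric.mem_closedBall_self (hr_pos _).le))
  calc c * μ S
      ≤ c * ∑' b : u, μ (Metric.closedBall b.1.1 (4 * r b)) := by
        gcongr
        exact (measure_mono hcover).trans (measure_biUnion_le _ hu _)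
    _ = 4 ^ Module.finrank ℝ E * ∑' b : u, c * μ (Metric.ball b.1.1 (r b)) := by
        rw [← ENNReal.tsum_mul_left, ← ENNReal.tsum_mul_left]
        congr 1 with b
        rw [Measure.addHaar_closedBall_eq_addHaar_ball, Measure.addHaar_ball_mul _ _ (by norm_num),
          Measure.addHaar_ball_center μ b.1.1, ENNReal.ofReal_pow (by norm_num),
          ENNReal.ofReal_ofNat]
        ring
    _ ≤ 4 ^ Module.finrank ℝ E * ∑' b : u, ∫⁻ y in Metric.ball b.1.1 (r b), f y ∂μ := by
        gcongr with b
        exact hr b.1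
    _ = 4 ^ Module.finrank ℝ E * ∫⁻ y in ⋃ b ∈ u, Metric.ball b.1 (r b), f y ∂μ := by
        rw [lintegral_biUnion hu (fun b _ => measurableSet_ball)
          (hdisj.mono fun b => Metric.ball_subset_closedBall)]
    _ ≤ 4 ^ Module.finrank ℝ E * ∫⁻ y, f y ∂μ :=
        mul_le_mul_right (setLIntegral_le_lintegral _ _) _

theorem mul_measure_lt_hlMaximal_le_setLIntegral [Nontrivial E] (f : E → ℝ≥0∞) {c : ℝ≥0∞}
    (hc : c ≠ 0) (hc' : c ≠ ⊤) :
    c * μ {x | c < hlMaximal μ f x} ≤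
      2 * 4 ^ Module.finrank ℝ E * ∫⁻ y in {y | c < 2 * f y}, f y ∂μ := by
  -- The values of `f` up to `c / 2` contribute at most `c / 2` to the maximal function.
  set g := {y | c < 2 * f y}.indicator f
  have hfg : ∀ y, f y ≤ g y + c / 2 := by
    intro y
    by_cases hy : y ∈ {y | c < 2 * f y}
    · simp only [g, Set.indicator_of_mem hy, le_self_add]
    · refine le_add_left ((ENNReal.le_div_iff_mul_le (by simp) (by simp)).2 ?_)
      exact mul_comm (f y) 2 ▸ not_lt.1 hy
  have hlevel : {x | c < hlMaximal μ f x} ⊆ {x | c / 2 < hlMaximal μ g x} := by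
    intro x (hx : c < _)
    by_contra hgx
    refine hx.not_ge ?_
    calc hlMaximal μ f x ≤ hlMaximal μ g x + c / 2 :=
          hlMaximal_le_add_of_ae_le_add (.of_forall hfg) x
      _ ≤ c / 2 + c / 2 := by
        gcongr
        exact not_lt.1 hgx
      _ = c := ENNReal.add_halves c
  calc c * μ {x | c < hlMaximal μ f x}
      ≤ c * μ {x | c / 2 < hlMaximal μ g x} := by gcongr
    _ = 2 * (c / 2 * μ {x | c / 2 < hlMaximal μ g x}) := by
        rw [← mul_assoc, ENNReal.mul_div_cancel (by simp) (by simp)]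
    _ ≤ 2 * (4 ^ Module.finrank ℝ E * ∫⁻ y, g y ∂μ) :=
        mul_le_mul_right (mul_measure_lt_hlMaximal_le g (ENNReal.half_pos hc).ne'
          (ENNReal.div_ne_top hc' two_ne_zero)) 2
    _ ≤ 2 * (4 ^ Module.finrank ℝ E * ∫⁻ y in {y | c < 2 * f y}, f y ∂μ) :=
        mul_le_mul_right (mul_le_mul_right (lintegral_indicator_le f _) _) 2
    _ = _ := (mul_assoc _ _ _).symm

theorem lintegral_hlMaximal_rpow_le [Nontrivial E] {f : E → ℝ≥0∞} (hf : AEMeasurable f μ) {q : ℝ}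
    (hq : 1 < q) :
    ∫⁻ x, hlMaximal μ f x ^ q ∂μ ≤
      2 ^ q * 4 ^ Module.finrank ℝ E * ENNReal.ofReal (q / (q - 1)) * ∫⁻ x, f x ^ q ∂μ := by
  have hpow : ∀ x, f x * (2 * f x) ^ (q - 1) = 2 ^ (q - 1) * f x ^ q := by
    intro x
    rw [ENNReal.mul_rpow_of_nonneg _ _ (sub_pos.2 hq).le, mul_left_comm]
    nth_rewrite 1 [← ENNReal.rpow_one (f x)]
    rw [← ENNReal.rpow_add_of_nonneg _ _ zero_le_one (sub_pos.2 hq).le, add_sub_cancel]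
  have htwo : (2 : ℝ≥0∞) ^ q = 2 * 2 ^ (q - 1) := by
    nth_rewrite 2 [← ENNReal.rpow_one 2]
    rw [← ENNReal.rpow_add _ _ two_ne_zero ENNReal.ofNat_ne_top, add_sub_cancel]
  calc ∫⁻ x, hlMaximal μ f x ^ q ∂μ
      ≤ 2 * 4 ^ Module.finrank ℝ E * ENNReal.ofReal (q / (q - 1)) *
          ∫⁻ x, f x * (2 * f x) ^ (q - 1) ∂μ :=
        lintegral_rpow_le_of_mul_measure_le hq (measurable_hlMaximal μ f).aemeasurable hf
          (hf.const_mul 2) fun t ht => mul_measure_lt_hlMaximal_le_setLIntegral f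
            (ENNReal.ofReal_pos.2 ht).ne' ENNReal.ofReal_ne_top
    _ = _ := by
        simp_rw [hpow]
        rw [lintegral_const_mul'' _ (hf.pow_const q), htwo]
        ring

theorem exists_eLpNorm_hlMaximal_le (μ : Measure E) [μ.IsAddHaarMeasure] [Nontrivial E] {q : ℝ≥0∞}
    (hq : 1 < q) :
    ∃ C : ℝ≥0, ∀ f : E → ℝ≥0∞, AEMeasurable f μ →
      eLpNorm (hlMaximal μ f) q μ ≤ C * eLpNorm f q μ := by
  rcases eq_or_ne q ⊤ with rfl | hq_top
  · refine ⟨1, fun f _ => ?_⟩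
    rw [ENNReal.coe_one, one_mul, eLpNorm_exponent_top]
    exact eLpNormEssSup_le_of_ae_enorm_bound (.of_forall (hlMaximal_le_eLpNorm_top μ f))
  have hq_one : 1 < q.toReal := by
    rwa [← ENNReal.toReal_one, ENNReal.toReal_lt_toReal ENNReal.one_ne_top hq_top]
  set A : ℝ≥0∞ :=
    2 ^ q.toReal * 4 ^ Module.finrank ℝ E * ENNReal.ofReal (q.toReal / (q.toReal - 1))
  have hA : A ^ (1 / q.toReal) ≠ ⊤ := by finiteness
  refine ⟨(A ^ (1 / q.toReal)).toNNReal, fun f hf => ?_⟩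
  rw [ENNReal.coe_toNNReal hA]
  simp only [eLpNorm_eq_lintegral_rpow_enorm_toReal (one_pos.trans hq).ne' hq_top, enorm_eq_self]
  rw [← ENNReal.mul_rpow_of_nonneg _ _ (by positivity)]
  gcongr
  exact lintegral_hlMaximal_rpow_le hf hq_one

end Maximal

section RadialKernel

variable {X : Type*} [PseudoMetricSpace X] [ProperSpace X] [MeasurableSpace X]
  {μ : Measure X} [IsFiniteMeasureOnCompacts μ] {w : ℝ → ℝ}

theorem setLIntegral_lt_comp_dist_le_mul_hlMaximal (hw : Continuous w)
    (hw_anti : AntitoneOn w (Set.Ici 0)) (f : X → ℝ≥0∞) (x : X) (t : ℝ) :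
    ∫⁻ y in {y | t < w (dist y x)}, f y ∂μ ≤ μ {y | t < w (dist y x)} * hlMaximal μ f x := by
  set S := {y | t < w (dist y x)}
  have hS : S = ⋃ r : {r : ℚ // Metric.ball x r ⊆ S}, Metric.ball x (r : ℚ) := by
    refine subset_antisymm (fun y hy => ?_) (Set.iUnion_subset fun r => r.2)
    obtain ⟨ε, hε, hε_lt⟩ := Metric.eventually_nhds_iff.1 (hw.continuousAt.eventually_const_lt hy)
    obtain ⟨r, hyr, hr⟩ := exists_rat_btwn (lt_add_of_pos_right (dist y x) hε)
    have hr_sub : Metric.ball x r ⊆ S := by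
      intro z hz
      rcases le_total (dist z x) (dist y x) with h | h
      · exact lt_of_lt_of_le hy (hw_anti dist_nonneg dist_nonneg h)
      · refine hε_lt ?_
        rw [Real.dist_eq, abs_of_nonneg (sub_nonneg.2 h), sub_lt_iff_lt_add']
        exact (Metric.mem_ball.1 hz).trans hr
    exact Set.mem_iUnion.2 ⟨⟨r, hr_sub⟩, Metric.mem_ball.2 hyr⟩
  have hmono : Monotone fun r : {r : ℚ // Metric.ball x r ⊆ S} => Metric.ball x (r : ℚ) :=
    fun r s hrs => Metric.ball_subset_ball (Rat.cast_le.2 hrs)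
  conv_lhs => rw [hS]
  rw [setLIntegral_iUnion_of_directed f hmono.directed_le]
  exact iSup_le fun r => (setLIntegral_ball_le_mul_hlMaximal μ f x r).trans
    (mul_le_mul_left (measure_mono r.2) _)

theorem lintegral_mul_ofReal_comp_dist_le [OpensMeasurableSpace X] (hw : Continuous w)
    (hw_nonneg : 0 ≤ w) (hw_anti : AntitoneOn w (Set.Ici 0)) {f : X → ℝ≥0∞}
    (hf : AEMeasurable f μ) (x : X) :
    ∫⁻ y, f y * ENNReal.ofReal (w (dist y x)) ∂μ ≤
      (∫⁻ y, ENNReal.ofReal (w (dist y x)) ∂μ) * hlMaximal μ f x := by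
  have hw_dist : Continuous fun y => w (dist y x) := by fun_prop
  have hlevel_anti : Antitone fun t : ℝ => μ {y | t < w (dist y x)} := fun s t hst =>
    measure_mono fun y hy => hst.trans_lt hy
  calc ∫⁻ y, f y * ENNReal.ofReal (w (dist y x)) ∂μ
      = ∫⁻ y, ENNReal.ofReal (w (dist y x)) ∂μ.withDensity f :=
        (lintegral_withDensity_eq_lintegral_mul₀ hf (by fun_prop)).symm
    _ = ∫⁻ t in Set.Ioi (0 : ℝ), μ.withDensity f {y | t < w (dist y x)} :=
        lintegral_eq_lintegral_meas_lt _ (.of_forall fun _ => hw_nonneg _) hw_dist.aemeasurable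
    _ ≤ ∫⁻ t in Set.Ioi (0 : ℝ), μ {y | t < w (dist y x)} * hlMaximal μ f x := by
        gcongr with t
        rw [withDensity_apply _ (measurableSet_lt measurable_const hw_dist.measurable)]
        exact setLIntegral_lt_comp_dist_le_mul_hlMaximal hw hw_anti f x t
    _ = (∫⁻ y, ENNReal.ofReal (w (dist y x)) ∂μ) * hlMaximal μ f x := by
        rw [lintegral_mul_const _ hlevel_anti.measurable,
          lintegral_eq_lintegral_meas_lt μ (.of_forall fun _ => hw_nonneg _) hw_dist.aemeasurable]

end RadialKernel

section CauchyWeight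

theorem lintegral_inv_one_add_mul_sq {a : ℝ} (ha : 0 < a) :
    ∫⁻ y : ℝ, ENNReal.ofReal (1 + (a * y) ^ 2)⁻¹ = ENNReal.ofReal (Real.pi / a) := by
  rw [← ofReal_integral_eq_lintegral_ofReal (integrable_inv_one_add_sq.comp_mul_left' ha.ne')
    (.of_forall fun y => by positivity), Measure.integral_comp_mul_left (fun y => (1 + y ^ 2)⁻¹),
    integral_univ_inv_one_add_sq, smul_eq_mul, abs_of_pos (inv_pos.2 ha), div_eq_inv_mul]

theorem lintegral_comp_sub_mul_inv_one_add_mul_sq_le {a : ℝ} (ha : 0 < a) {f : ℝ → ℝ≥0∞}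
    (hf : AEMeasurable f) (x : ℝ) :
    ∫⁻ y, f (x - y) * ENNReal.ofReal (1 + (a * y) ^ 2)⁻¹ ≤
      ENNReal.ofReal (Real.pi / a) * hlMaximal volume f x := by
  set w : ℝ → ℝ := fun s => (1 + (a * s) ^ 2)⁻¹
  have hw : Continuous w := Continuous.inv₀ (by fun_prop) fun s => by positivity
  have hw_anti : AntitoneOn w (Set.Ici 0) := by
    intro s (hs : 0 ≤ s) t _ hst
    simp only [w]
    gcongr
  have hw_dist : ∀ y, w (dist y x) = w (x - y) := by
    intro y
    simp only [w, Real.dist_eq, mul_pow, sq_abs, sub_sq_comm]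
  calc ∫⁻ y, f (x - y) * ENNReal.ofReal (w y)
      = ∫⁻ y, f y * ENNReal.ofReal (w (dist y x)) := by
        rw [← lintegral_sub_left_eq_self _ x]
        simp only [hw_dist, sub_sub_cancel]
    _ ≤ (∫⁻ y, ENNReal.ofReal (w (dist y x))) * hlMaximal volume f x :=
        lintegral_mul_ofReal_comp_dist_le hw (fun s => by positivity) hw_anti hf x
    _ = ENNReal.ofReal (Real.pi / a) * hlMaximal volume f x := by
        simp only [hw_dist]
        rw [lintegral_sub_left_eq_self (fun y => ENNReal.ofReal (w y)),
          lintegral_inv_one_add_mul_sq ha]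

end CauchyWeight

section Bessel

variable {𝕜 E ι : Type*} [RCLike 𝕜] [NormedAddCommGroup E] [InnerProductSpace 𝕜 E] {v : ι → E}

theorem tsum_enorm_inner_sq_le_of_orthonormal (hv : Orthonormal 𝕜 v) (x : E) :
    ∑' i, ‖inner 𝕜 (v i) x‖ₑ ^ 2 ≤ ‖x‖ₑ ^ 2 := by
  simp only [← ofReal_norm, ← ENNReal.ofReal_pow (norm_nonneg _)]
  rw [← ENNReal.ofReal_tsum_of_nonneg (fun i => sq_nonneg _) (hv.inner_products_summable x)]
  exact ENNReal.ofReal_le_ofReal (hv.tsum_inner_products_le x)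

theorem tsum_enorm_inner_sq_le_of_pairwise_orthogonal
    (hv : Pairwise fun i j => inner 𝕜 (v i) (v j) = 0) {D : ℝ≥0∞} (hD : ∀ i, ‖v i‖ₑ ^ 2 ≤ D)
    (x : E) :
    ∑' i, ‖inner 𝕜 (v i) x‖ₑ ^ 2 ≤ D * ‖x‖ₑ ^ 2 := by
  set S := {i | v i ≠ 0}
  set u : S → E := fun i => ((‖v i‖ : 𝕜)⁻¹) • v i
  have hu : Orthonormal 𝕜 u := by
    refine ⟨fun i => norm_smul_inv_norm i.2, fun i j hij => ?_⟩
    simp only [u, inner_smul_left, inner_smul_right, hv (Subtype.coe_ne_coe.2 hij), mul_zero]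
  have hvu : ∀ i : S, ‖inner 𝕜 (v i) x‖ₑ = ‖v i‖ₑ * ‖inner 𝕜 (u i) x‖ₑ := by
    intro i
    have hvi : v i = (‖v i‖ : 𝕜) • u i :=
      (smul_inv_smul₀ (RCLike.ofReal_ne_zero.2 (norm_ne_zero_iff.2 i.2)) _).symm
    conv_lhs => rw [hvi, inner_smul_left]
    rw [enorm_mul, RCLike.conj_ofReal, ← ofReal_norm (‖v i‖ : 𝕜), RCLike.norm_ofReal, abs_norm,
      ofReal_norm]
  calc ∑' i, ‖inner 𝕜 (v i) x‖ₑ ^ 2 = ∑' i : S, ‖inner 𝕜 (v i) x‖ₑ ^ 2 := by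
        refine (tsum_subtype_eq_of_support_subset fun i hi hvi => ?_).symm
        simp [hvi] at hi
    _ ≤ ∑' i : S, D * ‖inner 𝕜 (u i) x‖ₑ ^ 2 := by
        refine ENNReal.tsum_le_tsum fun i => ?_
        rw [hvu, mul_pow]
        exact mul_le_mul_left (hD i) _
    _ ≤ D * ‖x‖ₑ ^ 2 := by
        rw [ENNReal.tsum_mul_left]
        exact mul_le_mul_right (tsum_enorm_inner_sq_le_of_orthonormal hu x) D

end Bessel

section CauchyLift

theorem inner_toLp_fourierInv (φ ψ : 𝓢(ℝ, ℂ)) :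
    inner ℂ ((𝓕⁻ φ).toLp 2 volume) ((𝓕⁻ ψ).toLp 2 volume) =
      inner ℂ (φ.toLp 2 volume) (ψ.toLp 2 volume) := by
  rw [← SchwartzMap.toLp_fourierInv_eq, ← SchwartzMap.toLp_fourierInv_eq]
  exact (Lp.fourierTransformₗᵢ ℝ ℂ).symm.inner_map_map _ _

theorem fourierInv_derivCLM_apply {F : Type*} [NormedAddCommGroup F] [NormedSpace ℂ F]
    (φ : 𝓢(ℝ, F)) (y : ℝ) :
    𝓕⁻ (SchwartzMap.derivCLM ℂ F φ) y = -(2 * Real.pi * Complex.I * y) • 𝓕⁻ φ y := by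
  rw [SchwartzMap.fourierInv_coe, SchwartzMap.fourierInv_coe, Real.fourierInv_eq_fourier_neg,
    Real.fourierInv_eq_fourier_neg]
  have := congrFun (Real.fourier_deriv φ.integrable φ.differentiable
    (SchwartzMap.derivCLM ℂ F φ).integrable) (-y)
  refine this.trans ?_
  simp

/-- The Schwartz function whose inverse Fourier transform is `y ↦ (1 + (a y) ^ 2) 𝓕⁻ φ y`. Passing
to it splits the kernel `𝓕⁻ φ` into an integrable weight and a function with the same
frequency support as `φ`. -/
noncomputable def cauchyLift (a : ℝ) (φ : 𝓢(ℝ, ℂ)) : 𝓢(ℝ, ℂ) :=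
  φ - ((a / (2 * Real.pi) : ℂ) ^ 2) • SchwartzMap.derivCLM ℂ ℂ (SchwartzMap.derivCLM ℂ ℂ φ)

theorem fourierInv_cauchyLift_apply (a : ℝ) (φ : 𝓢(ℝ, ℂ)) (y : ℝ) :
    𝓕⁻ (cauchyLift a φ) y = (1 + (a * y) ^ 2 : ℝ) * 𝓕⁻ φ y := by
  rw [cauchyLift, sub_eq_add_neg, FourierTransform.fourierInv_add, FourierTransform.fourierInv_neg,
    FourierTransform.fourierInv_smul]
  simp only [add_apply, neg_apply, smul_apply, fourierInv_derivCLM_apply, smul_eq_mul]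
  push_cast
  field_simp
  linear_combination -(a : ℂ) ^ 2 * y ^ 2 * 𝓕⁻ φ y * Complex.I_sq

theorem tsupport_cauchyLift_subset (a : ℝ) (φ : 𝓢(ℝ, ℂ)) :
    tsupport (cauchyLift a φ) ⊆ tsupport φ := by
  have hderiv : tsupport (SchwartzMap.derivCLM ℂ ℂ (SchwartzMap.derivCLM ℂ ℂ φ)) ⊆ tsupport φ :=
    (SchwartzMap.tsupport_derivCLM_subset ℂ _).trans (SchwartzMap.tsupport_derivCLM_subset ℂ φ)
  refine (tsupport_sub _ _).trans (Set.union_subset subset_rfl ?_)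
  exact (tsupport_smul_subset_right (fun _ => ((a / (2 * Real.pi) : ℂ) ^ 2)) _).trans hderiv

theorem norm_cauchyLift_le (a : ℝ) (φ : 𝓢(ℝ, ℂ)) (ξ : ℝ) :
    ‖cauchyLift a φ ξ‖ ≤ ‖φ ξ‖ + a ^ 2 * ‖iteratedDeriv 2 φ ξ‖ := by
  have hderiv : SchwartzMap.derivCLM ℂ ℂ (SchwartzMap.derivCLM ℂ ℂ φ) ξ = iteratedDeriv 2 φ ξ := by
    rw [iteratedDeriv_eq_iterate]
    rfl
  rw [cauchyLift, sub_apply, smul_apply, hderiv]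
  refine (norm_sub_le _ _).trans (add_le_add_right ?_ _)
  have hpi : 1 ≤ 2 * Real.pi := by linarith [Real.pi_gt_three]
  rw [norm_smul]
  gcongr
  norm_cast
  rw [Real.norm_of_nonneg (sq_nonneg _), div_pow]
  exact div_le_self (sq_nonneg a) (one_le_pow₀ hpi)

end CauchyLift

theorem eLpNorm_two_sq {α E : Type*} [MeasurableSpace α] [NormedAddCommGroup E] (f : α → E)
    (μ : Measure α) : eLpNorm f 2 μ ^ 2 = ∫⁻ x, ‖f x‖ₑ ^ 2 ∂μ := by
  simpa using eLpNorm_nnreal_pow_eq_lintegral (p := 2) (f := f) (μ := μ) two_ne_zero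

section CutoffFamily

/-- A family of smooth frequency cutoffs on pairwise essentially disjoint sets of measure at most
`a`, each varying at scale `a` up to second order. This is all that the square function estimate
at one scale uses of the frequency intervals. -/
structure IsDisjointCutoffFamily {ι : Type*} (a B : ℝ) (φ : ι → 𝓢(ℝ, ℂ)) : Prop where
  pos : 0 < a
  volume_tsupport_le : ∀ i, volume (tsupport (φ i)) ≤ ENNReal.ofReal a
  aedisjoint : Pairwise (Function.onFun (AEDisjoint volume) fun i => tsupport (φ i))
  bound : ∀ i ξ, ‖φ i ξ‖ + a ^ 2 * ‖iteratedDeriv 2 (φ i) ξ‖ ≤ B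

namespace IsDisjointCutoffFamily

variable {ι : Type*} {a B : ℝ} {φ : ι → 𝓢(ℝ, ℂ)}

theorem inner_toLp_fourierInv_cauchyLift_eq_zero (h : IsDisjointCutoffFamily a B φ) {i j : ι}
    (hij : i ≠ j) :
    inner ℂ ((𝓕⁻ (cauchyLift a (φ i))).toLp 2 volume)
      ((𝓕⁻ (cauchyLift a (φ j))).toLp 2 volume) = 0 := by
  rw [inner_toLp_fourierInv, SchwartzMap.inner_toL2_toL2_eq _ _ volume]
  refine integral_eq_zero_of_ae ?_
  filter_upwards [measure_eq_zero_iff_ae_notMem.1 (h.aedisjoint hij)] with ξ hξ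
  by_cases hi : ξ ∈ tsupport (φ i)
  · have hj : cauchyLift a (φ j) ξ = 0 := image_eq_zero_of_notMem_tsupport fun hj =>
      hξ ⟨hi, tsupport_cauchyLift_subset a (φ j) hj⟩
    simp [hj]
  · have hi : cauchyLift a (φ i) ξ = 0 := image_eq_zero_of_notMem_tsupport fun hi' =>
      hi (tsupport_cauchyLift_subset a (φ i) hi')
    simp [hi]

theorem enorm_toLp_fourierInv_cauchyLift_sq_le (h : IsDisjointCutoffFamily a B φ) (i : ι) :
    ‖(𝓕⁻ (cauchyLift a (φ i))).toLp 2 volume‖ₑ ^ 2 ≤ ENNReal.ofReal B ^ 2 * ENNReal.ofReal a := by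
  have hsupp : Function.support (fun ξ => ‖cauchyLift a (φ i) ξ‖ₑ ^ 2) ⊆ tsupport (φ i) := by
    intro ξ hξ
    refine tsupport_cauchyLift_subset a (φ i) (subset_tsupport _ ?_)
    simpa using hξ
  calc ‖(𝓕⁻ (cauchyLift a (φ i))).toLp 2 volume‖ₑ ^ 2
      = ‖(cauchyLift a (φ i)).toLp 2 volume‖ₑ ^ 2 := by
        rw [← SchwartzMap.toLp_fourierInv_eq]
        congr 1
        exact (Lp.fourierTransformₗᵢ ℝ ℂ).symm.toLinearIsometry.enorm_map _
    _ = ∫⁻ ξ, ‖cauchyLift a (φ i) ξ‖ₑ ^ 2 := by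
        rw [SchwartzMap.toLp, Lp.enorm_toLp, eLpNorm_two_sq]
    _ ≤ ∫⁻ ξ in tsupport (φ i), ENNReal.ofReal B ^ 2 := by
        rw [← setLIntegral_eq_of_support_subset hsupp]
        gcongr with ξ
        rw [← ofReal_norm]
        exact ENNReal.ofReal_le_ofReal ((norm_cauchyLift_le a (φ i) ξ).trans (h.bound i ξ))
    _ ≤ ENNReal.ofReal B ^ 2 * ENNReal.ofReal a := by
        rw [setLIntegral_const]
        exact mul_le_mul_right (h.volume_tsupport_le i) _

end IsDisjointCutoffFamily

end CutoffFamily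

section FreqProj

theorem memLp_of_integrable_of_norm_le_one {α E : Type*} [MeasurableSpace α] {μ : Measure α}
    [NormedAddCommGroup E] {f : α → E} (hf : Integrable f μ) (hf_le : ∀ᵐ x ∂μ, ‖f x‖ ≤ 1)
    {q : ℝ≥0∞} (hq : 1 ≤ q) : MemLp f q μ := by
  rcases eq_or_ne q ⊤ with rfl | hq_top
  · exact memLp_top_of_bound hf.aestronglyMeasurable 1 hf_le
  have hq_one : 1 ≤ q.toReal := ENNReal.toReal_mono hq_top hq
  refine (integrable_norm_rpow_iff hf.aestronglyMeasurable (one_pos.trans_le hq).ne' hq_top).1 ?_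
  refine hf.mono (hf.norm.aemeasurable.pow_const _).aestronglyMeasurable ?_
  filter_upwards [hf_le] with x hx
  rw [Real.norm_of_nonneg (by positivity)]
  exact Real.rpow_le_self_of_le_one (norm_nonneg _) hx hq_one

variable {a : ℝ} {p : ℝ≥0∞} {f : ℝ → ℂ}

theorem memLp_inv_one_add_mul_sq (ha : a ≠ 0) {q : ℝ≥0∞} (hq : 1 ≤ q) :
    MemLp (fun y : ℝ => (((1 + (a * y) ^ 2)⁻¹ : ℝ) : ℂ)) q volume := by
  refine memLp_of_integrable_of_norm_le_one (integrable_inv_one_add_sq.comp_mul_left' ha).ofReal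
    (.of_forall fun y => ?_) hq
  rw [Complex.norm_real, Real.norm_of_nonneg (by positivity)]
  exact inv_le_one_of_one_le₀ (le_add_of_nonneg_right (sq_nonneg _))

theorem memLp_two_comp_sub_mul_inv_one_add_mul_sq (ha : a ≠ 0) (hp : 2 ≤ p)
    (hf : MemLp f p volume) (x : ℝ) :
    MemLp (fun y => f (x - y) * ((1 + (a * y) ^ 2)⁻¹ : ℝ)) 2 volume := by
  have hr : p⁻¹ + (2⁻¹ - p⁻¹) = 2⁻¹ := add_tsub_cancel_of_le (ENNReal.inv_le_inv.2 hp)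
  have : ENNReal.HolderTriple p (2⁻¹ - p⁻¹)⁻¹ 2 := ⟨by rw [inv_inv, hr]⟩
  have hr_one : 1 ≤ (2⁻¹ - p⁻¹ : ℝ≥0∞)⁻¹ :=
    ENNReal.one_le_inv.2 (tsub_le_self.trans (ENNReal.inv_le_one.2 one_le_two))
  exact (memLp_inv_one_add_mul_sq ha hr_one).mul'
    (hf.comp_measurePreserving (volume.measurePreserving_sub_left x))

theorem mul_fourierInv_eq (a : ℝ) (φ : 𝓢(ℝ, ℂ)) (c : ℂ) (y : ℝ) :
    c * 𝓕⁻ φ y = c * ((1 + (a * y) ^ 2)⁻¹ : ℝ) * 𝓕⁻ (cauchyLift a φ) y := by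
  have hpos : (1 + (a * y) ^ 2) ≠ 0 := by positivity
  rw [fourierInv_cauchyLift_apply, mul_assoc, ← mul_assoc _ _ (𝓕⁻ φ y), ← Complex.ofReal_mul,
    inv_mul_cancel₀ hpos, Complex.ofReal_one, one_mul]

theorem convolutionExists_fourierInv (hp : 2 ≤ p) (hf : MemLp f p volume) (φ : 𝓢(ℝ, ℂ)) :
    ConvolutionExists f (𝓕⁻ (φ : ℝ → ℂ)) (ContinuousLinearMap.mul ℂ ℂ) volume := by
  intro x
  rw [convolutionExistsAt_iff_integrable_swap, ← SchwartzMap.fourierInv_coe]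
  refine ((memLp_two_comp_sub_mul_inv_one_add_mul_sq one_ne_zero hp hf x).integrable_mul
    ((𝓕⁻ (cauchyLift 1 φ)).memLp 2 volume)).congr (.of_forall fun y => ?_)
  exact (mul_fourierInv_eq 1 φ (f (x - y)) y).symm

theorem enorm_freqProj_eq_enorm_inner {x : ℝ}
    (hf : MemLp (fun y => f (x - y) * ((1 + (a * y) ^ 2)⁻¹ : ℝ)) 2 volume) (φ : 𝓢(ℝ, ℂ)) :
    ‖freqProj φ f x‖ₑ =
      ‖inner ℂ ((𝓕⁻ (cauchyLift a φ)).toLp 2 volume) (hf.star.toLp _)‖ₑ := by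
  rw [← RCLike.enorm_conj]
  congr 1
  rw [freqProj, ← SchwartzMap.fourierInv_coe, convolution_eq_swap, L2.inner_def, ← integral_conj]
  refine integral_congr_ae ?_
  filter_upwards [(𝓕⁻ (cauchyLift a φ)).coeFn_toLp 2 volume, hf.star.coeFn_toLp] with y hy hfy
  rw [hy, hfy, ContinuousLinearMap.mul_apply', mul_fourierInv_eq a]
  simp

theorem IsDisjointCutoffFamily.tsum_enorm_freqProj_sq_le_eLpNorm_sq {ι : Type*} {B : ℝ}
    {φ : ι → 𝓢(ℝ, ℂ)} (h : IsDisjointCutoffFamily a B φ) {x : ℝ}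
    (hf : MemLp (fun y => f (x - y) * ((1 + (a * y) ^ 2)⁻¹ : ℝ)) 2 volume) :
    ∑' i, ‖freqProj (φ i) f x‖ₑ ^ 2 ≤ ENNReal.ofReal B ^ 2 * ENNReal.ofReal a *
      eLpNorm (fun y => f (x - y) * ((1 + (a * y) ^ 2)⁻¹ : ℝ)) 2 volume ^ 2 := by
  simp only [enorm_freqProj_eq_enorm_inner hf]
  rw [← eLpNorm_star, ← Lp.enorm_toLp hf.star]
  exact tsum_enorm_inner_sq_le_of_pairwise_orthogonal
    (fun i j hij => h.inner_toLp_fourierInv_cauchyLift_eq_zero hij)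
    h.enorm_toLp_fourierInv_cauchyLift_sq_le _

theorem eLpNorm_two_comp_sub_mul_inv_one_add_mul_sq_le (ha : 0 < a) (hf : AEMeasurable f)
    (x : ℝ) :
    eLpNorm (fun y => f (x - y) * ((1 + (a * y) ^ 2)⁻¹ : ℝ)) 2 volume ^ 2 ≤
      ENNReal.ofReal (Real.pi / a) * hlMaximal volume (fun y => ‖f y‖ₑ ^ 2) x := by
  refine le_trans ?_ (lintegral_comp_sub_mul_inv_one_add_mul_sq_le ha (hf.enorm.pow_const 2) x)
  rw [eLpNorm_two_sq]
  gcongr with y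
  have hw_le : ENNReal.ofReal (1 + (a * y) ^ 2)⁻¹ ≤ 1 :=
    ENNReal.ofReal_le_one.2 (inv_le_one_of_one_le₀ (le_add_of_nonneg_right (sq_nonneg _)))
  rw [enorm_mul, mul_pow, ← ofReal_norm (Complex.ofReal _), Complex.norm_real,
    Real.norm_of_nonneg (by positivity)]
  exact mul_le_mul_right (pow_le_of_le_one zero_le hw_le two_ne_zero) _

namespace IsDisjointCutoffFamily

variable {ι : Type*} {B : ℝ} {φ : ι → 𝓢(ℝ, ℂ)}

theorem tsum_enorm_freqProj_sq_lt_top (h : IsDisjointCutoffFamily a B φ) (hp : 2 ≤ p)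
    (hf : MemLp f p volume) (x : ℝ) : ∑' i, ‖freqProj (φ i) f x‖ₑ ^ 2 < ⊤ := by
  have hg := memLp_two_comp_sub_mul_inv_one_add_mul_sq h.pos.ne' hp hf x
  refine (h.tsum_enorm_freqProj_sq_le_eLpNorm_sq hg).trans_lt ?_
  have := hg.eLpNorm_ne_top
  finiteness

theorem tsum_enorm_freqProj_sq_le (h : IsDisjointCutoffFamily a B φ) (hp : 2 ≤ p)
    (hf : MemLp f p volume) (x : ℝ) :
    ∑' i, ‖freqProj (φ i) f x‖ₑ ^ 2 ≤
      ENNReal.ofReal B ^ 2 * ENNReal.ofReal Real.pi *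
        hlMaximal volume (fun y => ‖f y‖ₑ ^ 2) x := by
  calc ∑' i, ‖freqProj (φ i) f x‖ₑ ^ 2
      ≤ ENNReal.ofReal B ^ 2 * ENNReal.ofReal a *
          eLpNorm (fun y => f (x - y) * ((1 + (a * y) ^ 2)⁻¹ : ℝ)) 2 volume ^ 2 :=
        h.tsum_enorm_freqProj_sq_le_eLpNorm_sq
          (memLp_two_comp_sub_mul_inv_one_add_mul_sq h.pos.ne' hp hf x)
    _ ≤ ENNReal.ofReal B ^ 2 * ENNReal.ofReal a *
          (ENNReal.ofReal (Real.pi / a) * hlMaximal volume (fun y => ‖f y‖ₑ ^ 2) x) :=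
        mul_le_mul_right (eLpNorm_two_comp_sub_mul_inv_one_add_mul_sq_le h.pos
          hf.aestronglyMeasurable.aemeasurable x) _
    _ = _ := by
        rw [← mul_assoc, mul_assoc (_ ^ 2), ← ENNReal.ofReal_mul h.pos.le,
          mul_div_cancel₀ _ h.pos.ne']

end IsDisjointCutoffFamily

end FreqProj

section MaxSquare

theorem exists_eLpNorm_hlMaximal_rpow_le {E : Type*} [NormedAddCommGroup E] [NormedSpace ℝ E]
    [FiniteDimensional ℝ E] [MeasurableSpace E] [BorelSpace E] (μ : Measure E) [μ.IsAddHaarMeasure]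
    [Nontrivial E] {s : ℝ} {p : ℝ≥0∞} (hs : 0 < s) (hp : ENNReal.ofReal s < p) :
    ∃ C : ℝ≥0, ∀ f : E → ℝ≥0∞, AEMeasurable f μ →
      eLpNorm (fun x => hlMaximal μ (fun y => f y ^ s) x ^ s⁻¹) p μ ≤ C * eLpNorm f p μ := by
  have hs_ne : ENNReal.ofReal s ≠ 0 := (ENNReal.ofReal_pos.2 hs).ne'
  have hq : 1 < p * ENNReal.ofReal s⁻¹ := by
    rw [ENNReal.ofReal_inv_of_pos hs, ← div_eq_mul_inv]
    exact (ENNReal.lt_div_iff_mul_lt (.inl hs_ne) (.inl ENNReal.ofReal_ne_top)).2 (by rwa [one_mul])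
  obtain ⟨C, hC⟩ := exists_eLpNorm_hlMaximal_le μ hq
  refine ⟨C ^ s⁻¹, fun f hf => ?_⟩
  calc eLpNorm (fun x => hlMaximal μ (fun y => f y ^ s) x ^ s⁻¹) p μ
      = eLpNorm (hlMaximal μ fun y => f y ^ s) (p * ENNReal.ofReal s⁻¹) μ ^ s⁻¹ := by
        simpa using eLpNorm_enorm_rpow (hlMaximal μ fun y => f y ^ s) (inv_pos.2 hs)
    _ ≤ (C * eLpNorm (fun y => f y ^ s) (p * ENNReal.ofReal s⁻¹) μ) ^ s⁻¹ := by
        gcongr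
        exact hC _ (hf.pow_const s)
    _ = (C * eLpNorm f p μ ^ s) ^ s⁻¹ := by
        congr 2
        simpa [mul_assoc, ← ENNReal.ofReal_mul hs.le, ENNReal.ofReal_inv_of_pos hs,
          ENNReal.inv_mul_cancel hs_ne ENNReal.ofReal_ne_top] using
          eLpNorm_enorm_rpow (p := p * ENNReal.ofReal s⁻¹) (μ := μ) f hs
    _ = (C ^ s⁻¹ : ℝ≥0) * eLpNorm f p μ := by
        rw [ENNReal.mul_rpow_of_nonneg _ _ (inv_pos.2 hs).le, ENNReal.rpow_rpow_inv hs.ne',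
          ENNReal.coe_rpow_of_nonneg _ (inv_pos.2 hs).le]

theorem measurable_freqProj {φ f : ℝ → ℂ} (hφ : Continuous (𝓕⁻ φ))
    (hf : AEStronglyMeasurable f volume) : Measurable (freqProj φ f) := by
  have hmk : freqProj φ f = fun x => ∫ y, hf.mk f y * 𝓕⁻ φ (x - y) := by
    ext x
    refine integral_congr_ae ?_
    filter_upwards [hf.ae_eq_mk] with y hy
    rw [← hy, ContinuousLinearMap.mul_apply']
  rw [hmk]
  refine (StronglyMeasurable.integral_prod_right'
    (f := fun z : ℝ × ℝ => hf.mk f z.2 * 𝓕⁻ φ (z.1 - z.2)) ?_).measurable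
  exact (hf.stronglyMeasurable_mk.comp_measurable measurable_snd).mul
    (hφ.comp (by fun_prop)).stronglyMeasurable

theorem continuous_fourierInv (φ : 𝓢(ℝ, ℂ)) : Continuous (𝓕⁻ (φ : ℝ → ℂ)) := by
  rw [← SchwartzMap.fourierInv_coe]
  exact (𝓕⁻ φ).continuous

variable {κ ι : Type*}

/-- The maximal square function `sup_k (∑_m |φ k m-projection of f|²)^(1/2)`, which dominates the
bilinear operator by the Cauchy–Schwarz inequality in `m`. -/
noncomputable def maxSquare (φ : κ → ι → ℝ → ℂ) (f : ℝ → ℂ) (x : ℝ) : ℝ≥0∞ :=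
  ⨆ k, (∑' m, ‖freqProj (φ k m) f x‖ₑ ^ 2) ^ (2⁻¹ : ℝ)

theorem measurable_maxSquare [Countable κ] [Countable ι] {f : ℝ → ℂ}
    (hf : AEStronglyMeasurable f volume) (φ : κ → ι → 𝓢(ℝ, ℂ)) :
    Measurable (maxSquare (fun k m => φ k m) f) :=
  .iSup fun k => (Measurable.tsum fun m => (measurable_freqProj (continuous_fourierInv (φ k m))
    hf).enorm.pow_const 2).pow_const _

theorem maxSquare_le {a : κ → ℝ} {B : ℝ} {φ : κ → ι → 𝓢(ℝ, ℂ)}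
    (h : ∀ k, IsDisjointCutoffFamily (a k) B (φ k)) {p : ℝ≥0∞} (hp : 2 ≤ p) {f : ℝ → ℂ}
    (hf : MemLp f p volume) (x : ℝ) :
    maxSquare (fun k m => φ k m) f x ≤
      (ENNReal.ofReal B ^ 2 * ENNReal.ofReal Real.pi) ^ (2⁻¹ : ℝ) *
        hlMaximal volume (fun y => ‖f y‖ₑ ^ 2) x ^ (2⁻¹ : ℝ) := by
  refine iSup_le fun k => ?_
  rw [← ENNReal.mul_rpow_of_nonneg _ _ (by norm_num)]
  gcongr
  exact (h k).tsum_enorm_freqProj_sq_le hp hf x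

theorem exists_eLpNorm_maxSquare_le {p : ℝ≥0∞} (hp : 2 < p) (B : ℝ) :
    ∃ K : ℝ≥0, ∀ (a : κ → ℝ) (φ : κ → ι → 𝓢(ℝ, ℂ)),
      (∀ k, IsDisjointCutoffFamily (a k) B (φ k)) → ∀ f : ℝ → ℂ, MemLp f p volume →
        eLpNorm (maxSquare (fun k m => φ k m) f) p volume ≤ K * eLpNorm f p volume := by
  obtain ⟨C, hC⟩ := exists_eLpNorm_hlMaximal_rpow_le (volume : Measure ℝ) two_pos
    (by simpa using hp)
  set A : ℝ≥0∞ := (ENNReal.ofReal B ^ 2 * ENNReal.ofReal Real.pi) ^ (2⁻¹ : ℝ)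
  have hA : A ≠ ⊤ := by finiteness
  refine ⟨A.toNNReal * C, fun a φ h f hf => ?_⟩
  rw [ENNReal.coe_mul, mul_assoc]
  refine (eLpNorm_le_mul_eLpNorm_of_ae_le_mul' (.of_forall fun x => ?_) p).trans
    (mul_le_mul_right ((hC _ hf.aestronglyMeasurable.enorm).trans_eq ?_) _)
  · simpa [ENNReal.coe_toNNReal hA] using maxSquare_le h hp.le hf x
  · rw [eLpNorm_enorm]

end MaxSquare

section MaxBilinear

theorem tsum_mul_le_rpow_tsum_sq_mul_rpow_tsum_sq {ι : Type*} (u v : ι → ℝ≥0∞) :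
    ∑' i, u i * v i ≤ (∑' i, u i ^ 2) ^ (2⁻¹ : ℝ) * (∑' i, v i ^ 2) ^ (2⁻¹ : ℝ) := by
  let _ : MeasurableSpace ι := ⊤
  simpa [lintegral_count] using ENNReal.lintegral_mul_le_Lp_mul_Lq Measure.count
    Real.HolderConjugate.two_two (f := u) (g := v) measurable_from_top.aemeasurable
    measurable_from_top.aemeasurable

theorem eLpNorm_mul_le_eLpNorm_top_mul {α : Type*} [MeasurableSpace α] {μ : Measure α} {p : ℝ≥0∞}
    {F G : α → ℝ≥0∞} (hG : AEMeasurable G μ) :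
    eLpNorm (fun x => F x * G x) p μ ≤ eLpNorm F ⊤ μ * eLpNorm G p μ := by
  refine eLpNorm_le_mul_eLpNorm_of_ae_le_mul'' p hG.aestronglyMeasurable ?_
  filter_upwards [ae_le_eLpNormEssSup (f := F) (μ := μ)] with x hx
  exact mul_le_mul_left hx _

theorem eLpNorm_mul_le_of_holderTriple {α : Type*} [MeasurableSpace α] {μ : Measure α}
    {p q r : ℝ≥0∞} [hpqr : ENNReal.HolderTriple p q r] {F G : α → ℝ≥0∞} (hF : AEMeasurable F μ)
    (hG : AEMeasurable G μ) : eLpNorm (fun x => F x * G x) r μ ≤ eLpNorm F p μ * eLpNorm G q μ := by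
  have hinv := hpqr.inv_add_inv_eq_inv
  rcases eq_or_ne p 0 with rfl | hp_zero
  · obtain rfl : r = 0 := by simpa using hinv.symm
    simp
  rcases eq_or_ne q 0 with rfl | hq_zero
  · obtain rfl : r = 0 := by simpa using hinv.symm
    simp
  rcases eq_or_ne p ⊤ with rfl | hp_top
  · obtain rfl : q = r := by simpa using hinv
    exact eLpNorm_mul_le_eLpNorm_top_mul hG
  rcases eq_or_ne q ⊤ with rfl | hq_top
  · obtain rfl : p = r := by simpa using hinv
    simpa only [mul_comm] using eLpNorm_mul_le_eLpNorm_top_mul hF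
  have hp_pos : 0 < p.toReal := ENNReal.toReal_pos hp_zero hp_top
  have hq_pos : 0 < q.toReal := ENNReal.toReal_pos hq_zero hq_top
  have hr_inv : 1 / r.toReal = 1 / p.toReal + 1 / q.toReal := by
    simp only [one_div, ← ENNReal.toReal_inv, ← hinv]
    exact ENNReal.toReal_add (by simpa) (by simpa)
  have hr_pos : 0 < r.toReal := one_div_pos.1 (hr_inv ▸ by positivity)
  have hr := ENNReal.toReal_pos_iff.1 hr_pos
  rw [eLpNorm_eq_lintegral_rpow_enorm_toReal hr.1.ne' hr.2.ne,
    eLpNorm_eq_lintegral_rpow_enorm_toReal hp_zero hp_top,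
    eLpNorm_eq_lintegral_rpow_enorm_toReal hq_zero hq_top]
  refine ENNReal.lintegral_Lp_mul_le_Lq_mul_Lr hr_pos ?_ hr_inv μ hF hG
  exact lt_of_one_div_lt_one_div hp_pos (hr_inv ▸ lt_add_of_pos_right _ (by positivity))

variable {φ₁ φ₂ : ℤ → ℤ → ℝ → ℂ} {f₁ f₂ : ℝ → ℂ}

theorem tsum_enorm_tileTerm_le (k : ℤ) (x : ℝ) :
    ∑' m, ‖tileTerm φ₁ φ₂ f₁ f₂ k m x‖ₑ ≤
      (∑' m, ‖freqProj (φ₁ k m) f₁ x‖ₑ ^ 2) ^ (2⁻¹ : ℝ) *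
        (∑' m, ‖freqProj (φ₂ k m) f₂ x‖ₑ ^ 2) ^ (2⁻¹ : ℝ) := by
  simp only [tileTerm, enorm_mul]
  exact tsum_mul_le_rpow_tsum_sq_mul_rpow_tsum_sq _ _

theorem maxBilinear_le_maxSquare_mul_maxSquare (x : ℝ) :
    maxBilinear φ₁ φ₂ f₁ f₂ x ≤ maxSquare φ₁ f₁ x * maxSquare φ₂ f₂ x :=
  iSup_le fun k => enorm_tsum_le_tsum_enorm.trans <| (tsum_enorm_tileTerm_le k x).trans <|
    mul_le_mul' (le_iSup (fun k => (∑' m, ‖freqProj (φ₁ k m) f₁ x‖ₑ ^ 2) ^ (2⁻¹ : ℝ)) k)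
      (le_iSup (fun k => (∑' m, ‖freqProj (φ₂ k m) f₂ x‖ₑ ^ 2) ^ (2⁻¹ : ℝ)) k)

theorem measurable_maxBilinear (h₁ : ∀ k m, Measurable (freqProj (φ₁ k m) f₁))
    (h₂ : ∀ k m, Measurable (freqProj (φ₂ k m) f₂)) : Measurable (maxBilinear φ₁ φ₂ f₁ f₂) :=
  .iSup fun k => (Measurable.tsum fun m => (h₁ k m).mul (h₂ k m)).enorm

theorem maxBilinear_comm (φ₁ φ₂ : ℤ → ℤ → ℝ → ℂ) (f₁ f₂ : ℝ → ℂ) (x : ℝ) :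
    maxBilinear φ₁ φ₂ f₁ f₂ x = maxBilinear φ₂ φ₁ f₂ f₁ x := by
  simp only [maxBilinear, tileTerm, mul_comm (freqProj (φ₁ _ _) f₁ x)]

theorem maxBilinear_smul (φ₁ φ₂ : ℤ → ℤ → ℝ → ℂ) (c : ℂ) (f₁ f₂ : ℝ → ℂ) (x : ℝ) :
    maxBilinear φ₁ φ₂ (c • f₁) f₂ x = ‖c‖ₑ * maxBilinear φ₁ φ₂ f₁ f₂ x := by
  simp only [maxBilinear, tileTerm, freqProj, smul_convolution, Pi.smul_apply, smul_eq_mul,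
    mul_assoc, tsum_mul_left, enorm_mul, ENNReal.mul_iSup]

end MaxBilinear

section DisjointCutoffFamilies

variable {a₁ a₂ : ℤ → ℝ} {B₁ B₂ : ℝ} {φ₁ φ₂ : ℤ → ℤ → 𝓢(ℝ, ℂ)} {p₁ p₂ : ℝ≥0∞}

theorem summable_norm_tileTerm (h₁ : ∀ k, IsDisjointCutoffFamily (a₁ k) B₁ (φ₁ k))
    (h₂ : ∀ k, IsDisjointCutoffFamily (a₂ k) B₂ (φ₂ k)) (hp₁ : 2 ≤ p₁) (hp₂ : 2 ≤ p₂)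
    {f₁ f₂ : ℝ → ℂ} (hf₁ : MemLp f₁ p₁ volume) (hf₂ : MemLp f₂ p₂ volume) (k : ℤ) (x : ℝ) :
    Summable fun m => ‖tileTerm (fun k m => φ₁ k m) (fun k m => φ₂ k m) f₁ f₂ k m x‖ := by
  have hS₁ := ((h₁ k).tsum_enorm_freqProj_sq_lt_top hp₁ hf₁ x).ne
  have hS₂ := ((h₂ k).tsum_enorm_freqProj_sq_lt_top hp₂ hf₂ x).ne
  exact tsum_enorm_ne_top_iff_summable_norm.1
    (ne_top_of_le_ne_top (by finiteness) (tsum_enorm_tileTerm_le k x))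

theorem maxBilinear_add_le (h₁ : ∀ k, IsDisjointCutoffFamily (a₁ k) B₁ (φ₁ k))
    (h₂ : ∀ k, IsDisjointCutoffFamily (a₂ k) B₂ (φ₂ k)) (hp₁ : 2 ≤ p₁) (hp₂ : 2 ≤ p₂)
    {f g h : ℝ → ℂ} (hf : MemLp f p₁ volume) (hg : MemLp g p₁ volume) (hh : MemLp h p₂ volume)
    (x : ℝ) :
    maxBilinear (fun k m => φ₁ k m) (fun k m => φ₂ k m) (f + g) h x ≤
      maxBilinear (fun k m => φ₁ k m) (fun k m => φ₂ k m) f h x +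
        maxBilinear (fun k m => φ₁ k m) (fun k m => φ₂ k m) g h x := by
  refine iSup_le fun k => ?_
  have hadd : ∀ m, tileTerm (fun k m => φ₁ k m) (fun k m => φ₂ k m) (f + g) h k m x =
      tileTerm (fun k m => φ₁ k m) (fun k m => φ₂ k m) f h k m x +
        tileTerm (fun k m => φ₁ k m) (fun k m => φ₂ k m) g h k m x := fun m => by
    rw [tileTerm, freqProj, (convolutionExists_fourierInv hp₁ hf (φ₁ k m) x).add_distrib
      (convolutionExists_fourierInv hp₁ hg (φ₁ k m) x), add_mul]
    rfl
  simp only [hadd]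
  rw [(summable_norm_tileTerm h₁ h₂ hp₁ hp₂ hf hh k x).of_norm.tsum_add
    (summable_norm_tileTerm h₁ h₂ hp₁ hp₂ hg hh k x).of_norm]
  exact (enorm_add_le _ _).trans (add_le_add
    (le_iSup (fun k => ‖∑' m, tileTerm (fun k m => φ₁ k m) (fun k m => φ₂ k m) f h k m x‖ₑ) k)
    (le_iSup (fun k => ‖∑' m, tileTerm (fun k m => φ₁ k m) (fun k m => φ₂ k m) g h k m x‖ₑ) k))

theorem exists_eLpNorm_maxBilinear_le {p : ℝ≥0∞} [ENNReal.HolderTriple p₁ p₂ p] (hp₁ : 2 < p₁)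
    (hp₂ : 2 < p₂) (B₁ B₂ : ℝ) :
    ∃ K : ℝ≥0, ∀ (a₁ a₂ : ℤ → ℝ) (φ₁ φ₂ : ℤ → ℤ → 𝓢(ℝ, ℂ)),
      (∀ k, IsDisjointCutoffFamily (a₁ k) B₁ (φ₁ k)) →
      (∀ k, IsDisjointCutoffFamily (a₂ k) B₂ (φ₂ k)) →
      ∀ f₁ f₂ : ℝ → ℂ, MemLp f₁ p₁ volume → MemLp f₂ p₂ volume →
        eLpNorm (maxBilinear (fun k m => φ₁ k m) (fun k m => φ₂ k m) f₁ f₂) p volume ≤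
          K * eLpNorm f₁ p₁ volume * eLpNorm f₂ p₂ volume := by
  obtain ⟨K₁, hK₁⟩ := exists_eLpNorm_maxSquare_le (κ := ℤ) (ι := ℤ) hp₁ B₁
  obtain ⟨K₂, hK₂⟩ := exists_eLpNorm_maxSquare_le (κ := ℤ) (ι := ℤ) hp₂ B₂
  refine ⟨K₁ * K₂, fun a₁ a₂ φ₁ φ₂ h₁ h₂ f₁ f₂ hf₁ hf₂ => ?_⟩
  calc eLpNorm (maxBilinear (fun k m => φ₁ k m) (fun k m => φ₂ k m) f₁ f₂) p volume
      ≤ eLpNorm (fun x => maxSquare (fun k m => φ₁ k m) f₁ x *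
          maxSquare (fun k m => φ₂ k m) f₂ x) p volume :=
        eLpNorm_mono_enorm fun x => maxBilinear_le_maxSquare_mul_maxSquare x
    _ ≤ eLpNorm (maxSquare (fun k m => φ₁ k m) f₁) p₁ volume *
          eLpNorm (maxSquare (fun k m => φ₂ k m) f₂) p₂ volume :=
        eLpNorm_mul_le_of_holderTriple (measurable_maxSquare hf₁.1 φ₁).aemeasurable
          (measurable_maxSquare hf₂.1 φ₂).aemeasurable
    _ ≤ (K₁ * eLpNorm f₁ p₁ volume) * (K₂ * eLpNorm f₂ p₂ volume) :=
        mul_le_mul' (hK₁ a₁ φ₁ h₁ f₁ hf₁) (hK₂ a₂ φ₂ h₂ f₂ hf₂)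
    _ = (K₁ * K₂ : ℝ≥0) * eLpNorm f₁ p₁ volume * eLpNorm f₂ p₂ volume := by
        rw [ENNReal.coe_mul, mul_mul_mul_comm, ← mul_assoc]

theorem mainTheorem6_general {p : ℝ≥0∞} [ENNReal.HolderTriple p₁ p₂ p] (hp₁ : 2 < p₁)
    (hp₂ : 2 < p₂) (B₁ B₂ : ℝ) :
    ∃ K : ℝ≥0, ∀ (a₁ a₂ : ℤ → ℝ) (φ₁ φ₂ : ℤ → ℤ → 𝓢(ℝ, ℂ)),
      (∀ k, IsDisjointCutoffFamily (a₁ k) B₁ (φ₁ k)) →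
      (∀ k, IsDisjointCutoffFamily (a₂ k) B₂ (φ₂ k)) →
      letI T := maxBilinear (fun k m => φ₁ k m) (fun k m => φ₂ k m)
      (∀ f₁ f₂ : ℝ → ℂ, MemLp f₁ p₁ volume → MemLp f₂ p₂ volume →
        (∀ k m : ℤ,
          ConvolutionExists f₁ (𝓕⁻ (φ₁ k m : ℝ → ℂ)) (ContinuousLinearMap.mul ℂ ℂ) volume ∧
          ConvolutionExists f₂ (𝓕⁻ (φ₂ k m : ℝ → ℂ)) (ContinuousLinearMap.mul ℂ ℂ) volume) ∧
        (∀ (k : ℤ) (x : ℝ), Summable fun m =>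
          ‖tileTerm (fun k m => φ₁ k m) (fun k m => φ₂ k m) f₁ f₂ k m x‖) ∧
        AEMeasurable (T f₁ f₂) volume ∧
        eLpNorm (T f₁ f₂) p volume ≤ K * eLpNorm f₁ p₁ volume * eLpNorm f₂ p₂ volume) ∧
      (∀ (f g h : ℝ → ℂ) (c : ℂ) (x : ℝ),
        MemLp f p₁ volume → MemLp g p₁ volume → MemLp h p₂ volume →
          T (f + g) h x ≤ T f h x + T g h x ∧ T (c • f) h x = ‖c‖ₑ * T f h x) ∧
      (∀ (f g h : ℝ → ℂ) (c : ℂ) (x : ℝ),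
        MemLp f p₁ volume → MemLp g p₂ volume → MemLp h p₂ volume →
          T f (g + h) x ≤ T f g x + T f h x ∧ T f (c • g) x = ‖c‖ₑ * T f g x) := by
  obtain ⟨K, hK⟩ := exists_eLpNorm_maxBilinear_le (p := p) hp₁ hp₂ B₁ B₂
  refine ⟨K, fun a₁ a₂ φ₁ φ₂ h₁ h₂ => ⟨fun f₁ f₂ hf₁ hf₂ => ⟨fun k m => ⟨?_, ?_⟩, ?_, ?_, ?_⟩,
    fun f g h c x hf hg hh => ⟨?_, ?_⟩, fun f g h c x hf hg hh => ⟨?_, ?_⟩⟩⟩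
  · exact convolutionExists_fourierInv hp₁.le hf₁ (φ₁ k m)
  · exact convolutionExists_fourierInv hp₂.le hf₂ (φ₂ k m)
  · exact summable_norm_tileTerm h₁ h₂ hp₁.le hp₂.le hf₁ hf₂
  · exact (measurable_maxBilinear
      (fun k m => measurable_freqProj (continuous_fourierInv (φ₁ k m)) hf₁.1)
      fun k m => measurable_freqProj (continuous_fourierInv (φ₂ k m)) hf₂.1).aemeasurable
  · exact hK a₁ a₂ φ₁ φ₂ h₁ h₂ f₁ f₂ hf₁ hf₂
  · exact maxBilinear_add_le h₁ h₂ hp₁.le hp₂.le hf hg hh x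
  · exact maxBilinear_smul _ _ c f h x
  · simp only [maxBilinear_comm (fun k m => φ₁ k m)]
    exact maxBilinear_add_le h₂ h₁ hp₂.le hp₁.le hg hh hf x
  · simp only [maxBilinear_comm (fun k m => φ₁ k m)]
    exact maxBilinear_smul _ _ c g f x

end DisjointCutoffFamilies

section Grid

theorem reflectedGridInterval_eq_gridInterval (θ : ℝ) (k m : ℤ) :
    reflectedGridInterval θ k m = gridInterval (-θ - 1) k (-m) := by
  ext ξ
  simp only [reflectedGridInterval, gridInterval, Set.mem_ofPred_eq, Set.mem_Icc]
  push_cast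
  constructor <;> rintro ⟨hl, hr⟩ <;> constructor <;> linarith

theorem isCompact_gridInterval (θ : ℝ) (k m : ℤ) : IsCompact (gridInterval θ k m) :=
  isCompact_Icc

theorem volume_gridInterval (θ : ℝ) (k m : ℤ) :
    volume (gridInterval θ k m) = ENNReal.ofReal ((2 : ℝ) ^ k) := by
  rw [gridInterval, Real.volume_Icc]
  ring_nf

theorem gridInterval_inter_subset (θ : ℝ) (k : ℤ) {m n : ℤ} (hmn : m < n) :
    gridInterval θ k m ∩ gridInterval θ k n ⊆ {(2 : ℝ) ^ k * (n + θ)} := by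
  rintro ξ ⟨⟨-, hle⟩, ⟨hge, -⟩⟩
  refine le_antisymm (hle.trans ?_) hge
  have hmn' : (m : ℝ) + 1 ≤ n := by exact_mod_cast hmn
  exact mul_le_mul_of_nonneg_left (by linarith) (by positivity)

theorem pairwise_aedisjoint_gridInterval (θ : ℝ) (k : ℤ) :
    Pairwise (Function.onFun (AEDisjoint volume) (gridInterval θ k)) := by
  have : Std.Symm (Function.onFun (AEDisjoint volume) (gridInterval θ k)) := ⟨fun _ _ h => h.symm⟩
  exact pairwise_iff_lt.2 fun _ _ hmn =>
    measure_mono_null (gridInterval_inter_subset θ k hmn) (measure_singleton _)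

namespace IsAdaptedFamily

variable {C : ℕ → ℝ} {φ : ℤ → ℤ → ℝ → ℂ}

theorem exists_isDisjointCutoffFamily {J : ℤ → ℤ → Set ℝ} (h : IsAdaptedFamily C J φ)
    (hJ_compact : ∀ k m, IsCompact (J k m))
    (hJ_volume : ∀ k m, volume (J k m) ≤ ENNReal.ofReal ((2 : ℝ) ^ k))
    (hJ_disjoint : ∀ k, Pairwise (Function.onFun (AEDisjoint volume) (J k))) :
    ∃ ψ : ℤ → ℤ → 𝓢(ℝ, ℂ), φ = (fun k m => ⇑(ψ k m)) ∧
      ∀ k, IsDisjointCutoffFamily ((2 : ℝ) ^ k) (C 0 + C 2) (ψ k) := by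
  have htsupport : ∀ k m, tsupport (φ k m) ⊆ J k m := fun k m =>
    closure_minimal (h.support_subset k m) (hJ_compact k m).isClosed
  have hcompact : ∀ k m, HasCompactSupport (φ k m) := fun k m =>
    (hJ_compact k m).of_isClosed_subset (isClosed_tsupport _) (htsupport k m)
  refine ⟨fun k m => (hcompact k m).toSchwartzMap (h.smooth k m), rfl, fun k =>
    { pos := by positivity
      volume_tsupport_le := fun m => (measure_mono (htsupport k m)).trans (hJ_volume k m)
      aedisjoint := fun m n hmn => (hJ_disjoint k hmn).mono (htsupport k m) (htsupport k n)
      bound := fun m ξ => add_le_add ?_ ?_ }⟩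
  · simpa using h.bound 0 k m ξ
  · have := h.bound 2 k m ξ
    rwa [← div_eq_mul_inv, le_div_iff₀ (by positivity), mul_comm] at this

theorem exists_isDisjointCutoffFamily_of_gridInterval {θ : ℝ}
    (h : IsAdaptedFamily C (gridInterval θ) φ) :
    ∃ ψ : ℤ → ℤ → 𝓢(ℝ, ℂ), φ = (fun k m => ⇑(ψ k m)) ∧
      ∀ k, IsDisjointCutoffFamily ((2 : ℝ) ^ k) (C 0 + C 2) (ψ k) :=
  h.exists_isDisjointCutoffFamily (isCompact_gridInterval θ)
    (fun k m => (volume_gridInterval θ k m).le) (pairwise_aedisjoint_gridInterval θ)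

theorem exists_isDisjointCutoffFamily_of_reflectedGridInterval {θ : ℝ}
    (h : IsAdaptedFamily C (reflectedGridInterval θ) φ) :
    ∃ ψ : ℤ → ℤ → 𝓢(ℝ, ℂ), φ = (fun k m => ⇑(ψ k m)) ∧
      ∀ k, IsDisjointCutoffFamily ((2 : ℝ) ^ k) (C 0 + C 2) (ψ k) := by
  have heq : reflectedGridInterval θ = fun k m => gridInterval (-θ - 1) k (-m) :=
    funext₂ (reflectedGridInterval_eq_gridInterval θ)
  rw [heq] at h
  exact h.exists_isDisjointCutoffFamily (fun k m => isCompact_gridInterval _ k (-m))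
    (fun k m => (volume_gridInterval _ k (-m)).le)
    fun k m n hmn => pairwise_aedisjoint_gridInterval _ k (neg_injective.ne hmn)

end IsAdaptedFamily

end Grid

theorem holderTriple_ofReal {p q : ℝ} (hp : 0 < p) (hq : 0 < q) :
    ENNReal.HolderTriple (.ofReal p) (.ofReal q) (.ofReal (p * q / (p + q))) := ⟨by
  rw [← ENNReal.ofReal_inv_of_pos hp, ← ENNReal.ofReal_inv_of_pos hq,
    ← ENNReal.ofReal_inv_of_pos (by positivity), ← ENNReal.ofReal_add (by positivity)
    (by positivity)]
  congr 1
  field_simp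
  ring⟩

theorem mainTheorem6 (p₁ p₂ : ℝ) (hp₁ : 2 < p₁) (hp₂ : 2 < p₂) (C : ℕ → ℝ) :
    ∃ K : ℝ≥0, ∀ (θ : ℝ) (φ₁ φ₂ : ℤ → ℤ → ℝ → ℂ),
      IsAdaptedFamily C (gridInterval θ) φ₁ →
      IsAdaptedFamily C (reflectedGridInterval θ) φ₂ →
      -- the operator is well defined and bounded
      (∀ f₁ f₂ : ℝ → ℂ,
        MemLp f₁ (ENNReal.ofReal p₁) volume → MemLp f₂ (ENNReal.ofReal p₂) volume →
          (∀ k m : ℤ,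
            ConvolutionExists f₁ (𝓕⁻ (φ₁ k m)) (ContinuousLinearMap.mul ℂ ℂ) volume ∧
            ConvolutionExists f₂ (𝓕⁻ (φ₂ k m)) (ContinuousLinearMap.mul ℂ ℂ) volume) ∧
          (∀ (k : ℤ) (x : ℝ), Summable fun m : ℤ => ‖tileTerm φ₁ φ₂ f₁ f₂ k m x‖) ∧
          AEMeasurable (maxBilinear φ₁ φ₂ f₁ f₂) volume ∧
          eLpNorm (maxBilinear φ₁ φ₂ f₁ f₂) (ENNReal.ofReal (p₁ * p₂ / (p₁ + p₂))) volume ≤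
            K * eLpNorm f₁ (ENNReal.ofReal p₁) volume * eLpNorm f₂ (ENNReal.ofReal p₂) volume) ∧
      -- the operator is sublinear in the first argument
      (∀ (f g h : ℝ → ℂ) (c : ℂ) (x : ℝ),
        MemLp f (ENNReal.ofReal p₁) volume → MemLp g (ENNReal.ofReal p₁) volume →
        MemLp h (ENNReal.ofReal p₂) volume →
          maxBilinear φ₁ φ₂ (f + g) h x ≤
            maxBilinear φ₁ φ₂ f h x + maxBilinear φ₁ φ₂ g h x ∧
          maxBilinear φ₁ φ₂ (c • f) h x = ‖c‖ₑ * maxBilinear φ₁ φ₂ f h x) ∧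
      -- the operator is sublinear in the second argument
      (∀ (f g h : ℝ → ℂ) (c : ℂ) (x : ℝ),
        MemLp f (ENNReal.ofReal p₁) volume → MemLp g (ENNReal.ofReal p₂) volume →
        MemLp h (ENNReal.ofReal p₂) volume →
          maxBilinear φ₁ φ₂ f (g + h) x ≤
            maxBilinear φ₁ φ₂ f g x + maxBilinear φ₁ φ₂ f h x ∧
          maxBilinear φ₁ φ₂ f (c • g) x = ‖c‖ₑ * maxBilinear φ₁ φ₂ f g x) := by
  have hp₁' : 2 < ENNReal.ofReal p₁ := ENNReal.ofNat_lt_ofReal.2 hp₁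
  have hp₂' : 2 < ENNReal.ofReal p₂ := ENNReal.ofNat_lt_ofReal.2 hp₂
  have := holderTriple_ofReal (two_pos.trans hp₁) (two_pos.trans hp₂)
  obtain ⟨K, hK⟩ := mainTheorem6_general
    (p := .ofReal (p₁ * p₂ / (p₁ + p₂))) hp₁' hp₂' (C 0 + C 2) (C 0 + C 2)
  refine ⟨K, fun θ φ₁ φ₂ h₁ h₂ => ?_⟩
  obtain ⟨ψ₁, rfl, hψ₁⟩ := h₁.exists_isDisjointCutoffFamily_of_gridInterval
  obtain ⟨ψ₂, rfl, hψ₂⟩ := h₂.exists_isDisjointCutoffFamily_of_reflectedGridInterval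
  exact hK _ _ ψ₁ ψ₂ hψ₁ hψ₂
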